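/- Let $n\ge 0$ and consider on $\mathbb R^n\times[0,\infty)$ the Isaacs equation $$u_t-\mathcal I u=0,\qquad \mathcal I w(x)=\sup_i\inf_j\Big(c^{ij}+b^{ij}\cdot\nabla w(x)+\mathrm{p.v.}\!\int_{\mathbb R^n}\frac{w(x+y)-w(x)}{|y|^{n+1}}\,a^{ij}(y)\,dy\Big),\tag{1}$$ where $i,j$ range over arbitrary sets, the supremum and infimum are taken in $[-\infty,\infty]$, the $c^{ij}$ are real constants, the vectors $b^{ij}\in\mathbb R^n$ are bounded uniformly in $i,j$, and the kernels $a^{ij}:\mathbb R^n\to\mathbb R$ are measurable with $a^{ij}(y)=a^{ij}(-y)$ and $\lambda\le a^{ij}(y)\le\Lambda$ for all $y$, with constants $\lambda,\Lambda$, $\lambda>0$, independent of $i,j$. An upper (resp. lower) semicontinuous function $u$ on $\mathbb R^n\times[0,\infty)$ is a viscosity subsolution (resp. supersolution) of (1) if the following holds whenever $t>0$, $r>0$, $x\in\mathbb R^n$ and $\varphi:\mathbb R^n\times\mathbb R\to\mathbb R$ is a $C^2$ function with $\varphi(x,t)=u(x,t)$ and $\varphi(y,s)\ge u(y,s)$ (resp.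 $\le$) for all $(y,s)$ with $|x-y|<r$, $t-r<s\le t$, $s\ge 0$: the function $v$ that equals $\varphi$ in $B_r(x)\times(t-r,t+r)$ and $u$ elsewhere satisfies $v_t(x,t)-\mathcal I v(x,t)\le 0$ (resp. $\ge 0$). A viscosity solution is a continuous function that is both a subsolution and a supersolution. Let $u$ be a bounded viscosity solution of (1) such that $u_0=u(\cdot,0)$ is bounded and Lipschitz. Then for every $t\ge 0$ the function $u(\cdot,t)$ is Lipschitz, and $\|u(\cdot,t)\|_{Lip}\le\|u_0\|_{Lip}$, where $\|f\|_{Lip}=\sup_{x\ne y}|f(x)-f(y)|/|x-y|$ denotes the best Lipschitz constant. -/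

import Mathlib

open MeasureTheory Filter Topology
open scoped ENNReal

noncomputable section

namespace HamiltonJacobi

/-- The Lipschitz seminorm `sup_{x ≠ y} |f x - f y| / |x - y|`, with values in `[0, ∞]`. -/
def lipSeminorm {E : Type*} [PseudoEMetricSpace E] (f : E → ℝ) : ℝ≥0∞ :=
  ⨆ (x : E) (y : E) (_ : x ≠ y), edist (f x) (f y) / edist x y

/-- The integro-differential operator of order one with kernel `a`, applied to `w` at `x`:
`p.v. ∫ (w (x + y) - w x) / |y|^(n+1) * a y dy`, that is, the limit as `ε → 0+` of the
integrals over `|y| > ε`. -/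
def nonlocalOp {n : ℕ} (a : EuclideanSpace ℝ (Fin n) → ℝ)
    (w : EuclideanSpace ℝ (Fin n) → ℝ) (x : EuclideanSpace ℝ (Fin n)) : ℝ :=
  limUnder (𝓝[>] (0 : ℝ)) fun ε : ℝ =>
    ∫ y in {y : EuclideanSpace ℝ (Fin n) | ε < ‖y‖}, (w (x + y) - w x) / ‖y‖ ^ (n + 1) * a y

/-- The Isaacs operator `I w (x) = sup_i inf_j (c^{ij} + b^{ij} · ∇w(x) + L_{a^{ij}} w(x))`.
The supremum and the infimum are taken in `[-∞, ∞]`. -/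
def isaacsOp {n : ℕ} {ι κ : Type*} (c : ι → κ → ℝ) (b : ι → κ → EuclideanSpace ℝ (Fin n))
    (a : ι → κ → EuclideanSpace ℝ (Fin n) → ℝ)
    (w : EuclideanSpace ℝ (Fin n) → ℝ) (x : EuclideanSpace ℝ (Fin n)) : EReal :=
  ⨆ i, ⨅ j, ((c i j + inner ℝ (b i j) (gradient w x) + nonlocalOp (a i j) w x : ℝ) : EReal)

open Classical in
/-- The function equal to `φ` in the cylinder `U = B_r(x) × (t - r, t + r)` and to `u` outside. -/
def patch {n : ℕ} (φ : EuclideanSpace ℝ (Fin n) × ℝ → ℝ) (u : EuclideanSpace ℝ (Fin n) → ℝ → ℝ)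
    (x : EuclideanSpace ℝ (Fin n)) (t r : ℝ) : EuclideanSpace ℝ (Fin n) → ℝ → ℝ :=
  fun y s => if y ∈ Metric.ball x r ∧ s ∈ Set.Ioo (t - r) (t + r) then φ (y, s) else u y s

/-- `φ` touches `u` from above at `(x, t)`, in the part of `B_r(x) × (t - r, t]` that lies in the
domain `ℝⁿ × [0, ∞)` of `u`. -/
def TouchesFromAbove {n : ℕ} (φ : EuclideanSpace ℝ (Fin n) × ℝ → ℝ)
    (u : EuclideanSpace ℝ (Fin n) → ℝ → ℝ) (x : EuclideanSpace ℝ (Fin n)) (t r : ℝ) : Prop :=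
  φ (x, t) = u x t ∧
    ∀ y s, ‖x - y‖ < r → t - r < s → s ≤ t → 0 ≤ s → u y s ≤ φ (y, s)

/-- `φ` touches `u` from below at `(x, t)`, in the part of `B_r(x) × (t - r, t]` that lies in the
domain `ℝⁿ × [0, ∞)` of `u`. -/
def TouchesFromBelow {n : ℕ} (φ : EuclideanSpace ℝ (Fin n) × ℝ → ℝ)
    (u : EuclideanSpace ℝ (Fin n) → ℝ → ℝ) (x : EuclideanSpace ℝ (Fin n)) (t r : ℝ) : Prop :=
  φ (x, t) = u x t ∧
    ∀ y s, ‖x - y‖ < r → t - r < s → s ≤ t → 0 ≤ s → φ (y, s) ≤ u y s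

/-- Viscosity subsolutions of `u_t - I u = 0` in `ℝⁿ × [0, ∞)`. Only the values of `u` at times
`t ≥ 0` matter, and the equation is tested at times `t > 0`. -/
structure IsViscositySubsolution {n : ℕ} {ι κ : Type*} (c : ι → κ → ℝ)
    (b : ι → κ → EuclideanSpace ℝ (Fin n)) (a : ι → κ → EuclideanSpace ℝ (Fin n) → ℝ)
    (u : EuclideanSpace ℝ (Fin n) → ℝ → ℝ) : Prop where
  usc : UpperSemicontinuousOn (fun p : EuclideanSpace ℝ (Fin n) × ℝ => u p.1 p.2)
    (Set.univ ×ˢ Set.Ici 0)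
  test : ∀ (φ : EuclideanSpace ℝ (Fin n) × ℝ → ℝ) (x : EuclideanSpace ℝ (Fin n)) (t r : ℝ),
    ContDiff ℝ 2 φ → 0 < t → 0 < r → TouchesFromAbove φ u x t r →
      ((deriv (fun s => patch φ u x t r x s) t : ℝ) : EReal) ≤
        isaacsOp c b a (fun y => patch φ u x t r y t) x

/-- Viscosity supersolutions of `u_t - I u = 0` in `ℝⁿ × [0, ∞)`. Only the values of `u` at times
`t ≥ 0` matter, and the equation is tested at times `t > 0`. -/
structure IsViscositySupersolution {n : ℕ} {ι κ : Type*} (c : ι → κ → ℝ)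
    (b : ι → κ → EuclideanSpace ℝ (Fin n)) (a : ι → κ → EuclideanSpace ℝ (Fin n) → ℝ)
    (u : EuclideanSpace ℝ (Fin n) → ℝ → ℝ) : Prop where
  lsc : LowerSemicontinuousOn (fun p : EuclideanSpace ℝ (Fin n) × ℝ => u p.1 p.2)
    (Set.univ ×ˢ Set.Ici 0)
  test : ∀ (φ : EuclideanSpace ℝ (Fin n) × ℝ → ℝ) (x : EuclideanSpace ℝ (Fin n)) (t r : ℝ),
    ContDiff ℝ 2 φ → 0 < t → 0 < r → TouchesFromBelow φ u x t r →
      isaacsOp c b a (fun y => patch φ u x t r y t) x ≤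
        ((deriv (fun s => patch φ u x t r x s) t : ℝ) : EReal)

/-- Viscosity solutions: continuous functions on `ℝⁿ × [0, ∞)` that are both subsolutions and
supersolutions. -/
structure IsViscositySolution {n : ℕ} {ι κ : Type*} (c : ι → κ → ℝ)
    (b : ι → κ → EuclideanSpace ℝ (Fin n)) (a : ι → κ → EuclideanSpace ℝ (Fin n) → ℝ)
    (u : EuclideanSpace ℝ (Fin n) → ℝ → ℝ) : Prop where
  continuousOn : ContinuousOn (fun p : EuclideanSpace ℝ (Fin n) × ℝ => u p.1 p.2)
    (Set.univ ×ˢ Set.Ici 0)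
  sub : IsViscositySubsolution c b a u
  super : IsViscositySupersolution c b a u

end HamiltonJacobi

end

/-!
The estimate is a maximum principle applied to `u x t - u y t - K √(δ² + |x - y|²)`, where `K` is
larger than the Lipschitz constant of `u(·, 0)`. If this were positive somewhere, it would have an
approximate positive maximum in doubled variables: one subtracts a localising term `β growth x`,
the penalty `(t - s)² / (2ε)` for using different times, and `η t`. For small `ε` the maximum is
not at time zero, because `u` is uniformly continuous on compact sets and `u(·, 0)` is Lipschitz.

At a maximum `(x₀, y₀, t₀, s₀)` with positive times, freezing one pair of variables gives smooth
functions touching `u` from above at `(x₀, t₀)` and from below at `(y₀, s₀)`. Their time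
derivatives differ by `η`; their gradients agree up to `β ∇growth`, since the penalty depends on
`x - y` only. For the nonlocal terms, comparing the maximum with its translates by `(z, z)` shows
that outside the ball of radius `r` the increments of `u` at `x₀` exceed those at `y₀` by at most
the increments of `β growth`. Inside the ball the second differences of the penalty are
`O(|z|²)`, which against the kernel of order one contributes `O(√r)`. So `η ≤ C (β + √r)`
(`slope_le_of_isMax`), which is absurd for small `β` and `r`. Since the operator has order less
than two, no estimate for second derivatives of semicontinuous functions is needed.

The principal values are handled in `nonlocalOp_eq`: for an even kernel they are absolutely
convergent integrals of second differences. All second differences that occur are bounded by one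
integrable `weight`. The values of the operator lie in `[-∞, ∞]`, but only the inequality
`sup inf f ≤ sup inf g + d` for `f ≤ g + d` with real `d` is used (`iSup_iInf_le_add`), so
infinite values cause no difficulty.
-/

namespace HamiltonJacobi

/-! ### A weight integrable against the kernel of order one -/

/-- The weight `min (ρ ^ (3/2)) (ρ ^ (1/2))`. It dominates both `min (ρ ^ 2) 1` and
`min (ρ ^ 2) (ρ ^ (1/2))`, and `weight ‖z‖ / ‖z‖ ^ (n + 1)` is integrable over `ℝⁿ`, so every
second difference in the proof can be compared with it. -/
noncomputable def weight (ρ : ℝ) : ℝ := √ρ * min ρ 1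

lemma weight_nonneg {ρ : ℝ} (h : 0 ≤ ρ) : 0 ≤ weight ρ := by
  unfold weight; positivity

lemma weight_pos {ρ : ℝ} (h : 0 < ρ) : 0 < weight ρ := by
  unfold weight; positivity

lemma weight_mono {ρ σ : ℝ} (h : 0 ≤ ρ) (hρσ : ρ ≤ σ) : weight ρ ≤ weight σ := by
  unfold weight
  gcongr

lemma sqrt_eq_weight {ρ : ℝ} (h : 1 ≤ ρ) : √ρ = weight ρ := by
  simp [weight, min_eq_right h]

lemma sq_le_sqrt_mul_weight {ρ r : ℝ} (h : 0 ≤ ρ) (hr : ρ ≤ r) (h1 : ρ ≤ 1) :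
    ρ ^ 2 ≤ √r * weight ρ := by
  have h2 : √ρ ≤ √r := Real.sqrt_le_sqrt hr
  have h3 : √ρ * √ρ = ρ := Real.mul_self_sqrt h
  rw [weight, min_eq_left h1]
  calc ρ ^ 2 = √ρ * (√ρ * ρ) := by rw [← mul_assoc, h3, sq]
    _ ≤ √r * (√ρ * ρ) := by gcongr

lemma sq_le_weight {ρ : ℝ} (h : 0 ≤ ρ) (h1 : ρ ≤ 1) : ρ ^ 2 ≤ weight ρ := by
  simpa using sq_le_sqrt_mul_weight h h1 h1

lemma integrable_weight (n : ℕ) [NeZero n] :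
    Integrable (fun z : EuclideanSpace ℝ (Fin n) => weight ‖z‖ / ‖z‖ ^ (n + 1)) := by
  have hn : n ≠ 0 := NeZero.ne n
  rw [integrable_fun_norm_addHaar volume (f := fun ρ => weight ρ / ρ ^ (n + 1))]
  simp only [finrank_euclideanSpace, Fintype.card_fin, smul_eq_mul]
  have key : ∀ ρ : ℝ, 0 < ρ → ρ ^ (n - 1) * (weight ρ / ρ ^ (n + 1)) = weight ρ / ρ ^ 2 := by
    intro ρ hρ
    obtain ⟨m, rfl⟩ := Nat.exists_eq_succ_of_ne_zero hn
    simp only [Nat.succ_eq_add_one, Nat.add_sub_cancel]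
    field_simp
    ring
  rw [← Set.Ioc_union_Ioi_eq_Ioi (zero_le_one' ℝ)]
  refine IntegrableOn.union ?_ ?_
  · have := (intervalIntegral.intervalIntegrable_rpow' (a := 0) (b := 1) (r := -(1/2))
      (by norm_num)).1
    refine this.congr_fun ?_ measurableSet_Ioc
    intro ρ hρ
    beta_reduce
    rw [key ρ hρ.1, weight, min_eq_left hρ.2, Real.rpow_neg hρ.1.le, ← Real.sqrt_eq_rpow]
    have h3 : √ρ * √ρ = ρ := Real.mul_self_sqrt hρ.1.le
    have h4 : 0 < √ρ := Real.sqrt_pos.2 hρ.1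
    have := hρ.1
    field_simp
    nlinarith
  · have := integrableOn_Ioi_rpow_of_lt (a := -(3/2)) (c := 1) (by norm_num) one_pos
    refine this.congr_fun ?_ measurableSet_Ioi
    intro ρ hρ
    have hρ1 : (1 : ℝ) < ρ := hρ
    have hρ0 : 0 < ρ := one_pos.trans hρ1
    beta_reduce
    rw [key ρ hρ0, ← sqrt_eq_weight hρ1.le, Real.rpow_neg hρ0.le,
      show (3 / 2 : ℝ) = 1 + 1 / 2 by norm_num, Real.rpow_add hρ0, Real.rpow_one,
      ← Real.sqrt_eq_rpow]
    have h3 : √ρ * √ρ = ρ := Real.mul_self_sqrt hρ0.le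
    have h4 : 0 < √ρ := Real.sqrt_pos.2 hρ0
    field_simp
    nlinarith

/-! ### Second differences and the principal value -/

/-- The symmetric second difference `w (x + z) + w (x - z) - 2 w x`. -/
def secondDiff {E : Type*} [AddCommGroup E] (w : E → ℝ) (x z : E) : ℝ :=
  w (x + z) + w (x - z) - 2 * w x

lemma secondDiff_zero {E : Type*} [AddCommGroup E] (w : E → ℝ) (x : E) :
    secondDiff w x 0 = 0 := by
  simp only [secondDiff, add_zero, sub_zero]; ring

section PrincipalValue

variable {n : ℕ} {a w : EuclideanSpace ℝ (Fin n) → ℝ} {x : EuclideanSpace ℝ (Fin n)}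
  {lam Lam M C : ℝ}

lemma abs_kernel_le (ha_ell : ∀ y, lam ≤ a y ∧ a y ≤ Lam) (hlam : 0 < lam)
    (f g : EuclideanSpace ℝ (Fin n) → ℝ) (z : EuclideanSpace ℝ (Fin n)) (h : |f z| ≤ g z) :
    ‖f z / ‖z‖ ^ (n + 1) * a z‖ ≤ Lam * (g z / ‖z‖ ^ (n + 1)) := by
  have h1 := ha_ell z
  have h2 : 0 ≤ g z := (abs_nonneg _).trans h
  rw [norm_mul, norm_div, norm_pow, norm_norm, Real.norm_eq_abs, Real.norm_eq_abs,
    abs_of_pos (hlam.trans_le h1.1), mul_comm]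
  gcongr
  · exact (hlam.trans_le h1.1).le.trans h1.2
  · exact h1.2

lemma integrable_kernel [NeZero n] (ha_ell : ∀ y, lam ≤ a y ∧ a y ≤ Lam) (hlam : 0 < lam)
    (ha_meas : AEMeasurable a volume) {f : EuclideanSpace ℝ (Fin n) → ℝ} (hf : Measurable f)
    (hfC : ∀ z, |f z| ≤ C * weight ‖z‖) :
    Integrable fun z => f z / ‖z‖ ^ (n + 1) * a z := by
  refine (((integrable_weight n).const_mul C).const_mul Lam).mono'
    ((by fun_prop : AEMeasurable _ _).aestronglyMeasurable) (.of_forall fun z => ?_)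
  rw [← mul_div_assoc]
  exact abs_kernel_le ha_ell hlam f (fun z => C * weight ‖z‖) z (hfC z)

lemma measurable_secondDiff (hw : Measurable w) : Measurable (secondDiff w x) := by
  unfold secondDiff; fun_prop

/-- The principal value exists when the second difference at `x` is controlled by the weight, and
is then the absolutely convergent integral of half the second difference: by the symmetry of the
kernel the truncated integrals may be averaged with their reflections. -/
lemma nonlocalOp_eq [NeZero n] (ha_meas : AEMeasurable a volume) (ha_symm : ∀ y, a y = a (-y))
    (ha_ell : ∀ y, lam ≤ a y ∧ a y ≤ Lam) (hlam : 0 < lam)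
    (hw : Measurable w) (hwM : ∀ y, |w y| ≤ M)
    (hwC : ∀ z, |secondDiff w x z| ≤ C * weight ‖z‖) :
    nonlocalOp a w x = ∫ z, (secondDiff w x z / 2) / ‖z‖ ^ (n + 1) * a z := by
  have hF : Integrable fun z => (secondDiff w x z / 2) / ‖z‖ ^ (n + 1) * a z := by
    refine integrable_kernel (C := C) ha_ell hlam ha_meas
      ((measurable_secondDiff hw).div_const 2) fun z => ?_
    rw [abs_div, abs_two]
    linarith [hwC z, abs_nonneg (secondDiff w x z)]
  have hmeas : ∀ ε : ℝ, MeasurableSet {y : EuclideanSpace ℝ (Fin n) | ε < ‖y‖} := fun ε =>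
    measurableSet_lt measurable_const measurable_norm
  have hsym : ∀ ε : ℝ, 0 < ε →
      ∫ y in {y : EuclideanSpace ℝ (Fin n) | ε < ‖y‖},
        (w (x + y) - w x) / ‖y‖ ^ (n + 1) * a y =
      ∫ z in {y : EuclideanSpace ℝ (Fin n) | ε < ‖y‖},
        (secondDiff w x z / 2) / ‖z‖ ^ (n + 1) * a z := by
    intro ε hε
    rw [← integral_indicator (hmeas ε), ← integral_indicator (hmeas ε)]
    set H : EuclideanSpace ℝ (Fin n) → ℝ := Set.indicator {y | ε < ‖y‖}
      fun y => (w (x + y) - w x) / ‖y‖ ^ (n + 1) * a y with hH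
    have hHi : Integrable H := by
      have : H = fun y => Set.indicator {y : EuclideanSpace ℝ (Fin n) | ε < ‖y‖}
          (fun y => w (x + y) - w x) y / ‖y‖ ^ (n + 1) * a y := by
        funext y
        by_cases hy : ε < ‖y‖ <;> simp [hH, Set.indicator, hy]
      rw [this]
      refine integrable_kernel (C := 2 * M / weight ε) ha_ell hlam ha_meas
        (Measurable.indicator (by fun_prop) (hmeas ε)) fun y => ?_
      have hM : 0 ≤ M := (abs_nonneg _).trans (hwM x)
      have hε' := weight_pos hε
      by_cases hy : ε < ‖y‖
      · rw [Set.indicator_of_mem (by exact hy), div_mul_eq_mul_div, le_div_iff₀ hε']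
        have h1 : |w (x + y) - w x| ≤ 2 * M := by
          have := abs_sub (w (x + y)) (w x)
          linarith [hwM (x + y), hwM x]
        exact mul_le_mul h1 (weight_mono hε.le hy.le) hε'.le (by positivity)
      · rw [Set.indicator_of_notMem (by exact hy), abs_zero]
        have := weight_nonneg (norm_nonneg y)
        positivity
    have hneg := integral_neg_eq_self H volume
    have hadd : ∫ z, (H z + H (-z)) / 2 = ∫ z, H z := by
      rw [integral_div, integral_add hHi hHi.comp_neg, hneg]
      ring
    rw [← hadd]
    congr 1
    funext z
    by_cases hz : ε < ‖z‖
    · simp only [hH, Set.indicator, Set.mem_ofPred_eq, hz, norm_neg, if_true, ← ha_symm z,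
        secondDiff, ← sub_eq_add_neg]
      ring
    · simp [hH, Set.indicator, hz]
  unfold nonlocalOp
  refine Tendsto.limUnder_eq ?_
  have hlim : Tendsto (fun ε : ℝ => ∫ z in {y : EuclideanSpace ℝ (Fin n) | ε < ‖y‖},
      (secondDiff w x z / 2) / ‖z‖ ^ (n + 1) * a z) (𝓝[>] 0)
      (𝓝 (∫ z, (secondDiff w x z / 2) / ‖z‖ ^ (n + 1) * a z)) := by
    simp_rw [← integral_indicator (hmeas _)]
    refine tendsto_integral_filter_of_dominated_convergence _
      (.of_forall fun ε => hF.aestronglyMeasurable.indicator (hmeas ε))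
      (.of_forall fun ε => .of_forall fun z => norm_indicator_le_norm_self _ z) hF.norm
      (.of_forall fun z => ?_)
    rcases eq_or_ne z 0 with rfl | hz
    · refine tendsto_const_nhds.congr fun ε => ?_
      by_cases h : ε < ‖(0 : EuclideanSpace ℝ (Fin n))‖ <;>
        simp [Set.indicator, secondDiff_zero]
    · refine tendsto_const_nhds.congr' ?_
      filter_upwards [nhdsWithin_le_nhds (Iio_mem_nhds (norm_pos_iff.2 hz))] with ε hε
      rw [Set.indicator_of_mem (by exact hε)]
  refine hlim.congr' ?_
  filter_upwards [self_mem_nhdsWithin] with ε hε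
  exact (hsym ε hε).symm

end PrincipalValue

/-! ### Second differences of test functions and of patched functions -/

lemma exists_secondDiff_le_sq {E : Type*} [NormedAddCommGroup E] [NormedSpace ℝ E] {f : E → ℝ}
    (hf : ContDiff ℝ 2 f) (x : E) :
    ∃ C ρ : ℝ, 0 ≤ C ∧ 0 < ρ ∧ ∀ z, ‖z‖ < ρ → |secondDiff f x z| ≤ C * ‖z‖ ^ 2 := by
  have hd : Differentiable ℝ f := hf.differentiable (by norm_num)
  have h1 : ContDiffAt ℝ 1 (fderiv ℝ f) x :=
    (hf.fderiv_right (m := 1) (by norm_num)).contDiffAt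
  obtain ⟨K, t, ht, hK⟩ := h1.exists_lipschitzOnWith
  obtain ⟨ρ, hρ, hball⟩ := Metric.mem_nhds_iff.1 ht
  have hone : ∀ z, ‖z‖ < ρ → |f (x + z) - f x - fderiv ℝ f x z| ≤ K * ‖z‖ ^ 2 := by
    intro z hz
    have := Convex.norm_image_sub_le_of_norm_fderiv_le' (𝕜 := ℝ) (f := f)
      (s := Metric.closedBall x ‖z‖) (x := x) (y := x + z) (φ := fderiv ℝ f x) (C := K * ‖z‖)
      (fun y _ => hd y) (fun y hy => ?_) (convex_closedBall _ _) (by simp) (by simp)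
    · rw [add_sub_cancel_left, Real.norm_eq_abs] at this
      rwa [sq, ← mul_assoc]
    · have hy' : dist y x ≤ ‖z‖ := hy
      have := hK.dist_le_mul y (hball (hy'.trans_lt hz)) x (mem_of_mem_nhds ht)
      rw [dist_eq_norm] at this
      exact this.trans (by gcongr)
  refine ⟨2 * K, ρ, by positivity, hρ, fun z hz => ?_⟩
  have e1 := hone z hz
  have e2 := hone (-z) (by rwa [norm_neg])
  rw [norm_neg, map_neg, ← sub_eq_add_neg] at e2
  have : secondDiff f x z = (f (x + z) - f x - fderiv ℝ f x z) +
      (f (x - z) - f x - -(fderiv ℝ f x z)) := by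
    unfold secondDiff; ring
  rw [this]
  exact (abs_add_le _ _).trans (by linarith)

open Classical in
/-- A bounded continuous function, replaced in a ball by a function of class `C²`, has all the
properties under which the principal value at the centre of the ball exists. -/
lemma patched_bounds {n : ℕ} {f g : EuclideanSpace ℝ (Fin n) → ℝ} (hf : ContDiff ℝ 2 f)
    (hg : Continuous g) {M : ℝ} (hgM : ∀ y, |g y| ≤ M) (x : EuclideanSpace ℝ (Fin n)) {r : ℝ}
    (hr : 0 < r) :
    Measurable (fun y => if y ∈ Metric.ball x r then f y else g y) ∧
      (∃ M', ∀ y, |if y ∈ Metric.ball x r then f y else g y| ≤ M') ∧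
      ∃ C, ∀ z, |secondDiff (fun y => if y ∈ Metric.ball x r then f y else g y) x z| ≤
        C * weight ‖z‖ := by
  set w : EuclideanSpace ℝ (Fin n) → ℝ := fun y => if y ∈ Metric.ball x r then f y else g y
  have hw : Measurable w :=
    Measurable.ite Metric.isOpen_ball.measurableSet hf.continuous.measurable hg.measurable
  obtain ⟨Mf, hMf⟩ := (isCompact_closedBall x r).exists_bound_of_continuousOn
    hf.continuous.continuousOn
  have hwM : ∀ y, |w y| ≤ max M Mf := by
    intro y
    by_cases hy : y ∈ Metric.ball x r
    · simp only [w, if_pos hy]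
      exact (hMf y (Metric.ball_subset_closedBall hy)).trans (le_max_right _ _)
    · simp only [w, if_neg hy]
      exact (hgM y).trans (le_max_left _ _)
  refine ⟨hw, ⟨_, hwM⟩, ?_⟩
  obtain ⟨C, ρ, hC, hρ, hfC⟩ := exists_secondDiff_le_sq hf x
  set R := min (min ρ r) 1
  have hR : 0 < R := by positivity
  set B := max M Mf
  have hB : 0 ≤ B := (abs_nonneg _).trans (hwM x)
  have hwR := weight_pos hR
  refine ⟨C + 4 * B / weight R, fun z => ?_⟩
  have hz0 := weight_nonneg (norm_nonneg z)
  rcases lt_or_ge ‖z‖ R with hz | hz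
  · have hzr : ‖z‖ < r := hz.trans_le ((min_le_left _ _).trans (min_le_right _ _))
    have : secondDiff w x z = secondDiff f x z := by
      have h1 : x + z ∈ Metric.ball x r := by simpa using hzr
      have h2 : x - z ∈ Metric.ball x r := by simpa [sub_eq_add_neg] using hzr
      simp only [secondDiff, w, if_pos h1, if_pos h2, if_pos (Metric.mem_ball_self hr)]
    rw [this]
    calc |secondDiff f x z| ≤ C * ‖z‖ ^ 2 :=
          hfC z (hz.trans_le ((min_le_left _ _).trans (min_le_left _ _)))
      _ ≤ C * weight ‖z‖ := by
          gcongr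
          exact sq_le_weight (norm_nonneg z) (hz.le.trans (min_le_right _ _))
      _ ≤ (C + 4 * B / weight R) * weight ‖z‖ := by
          gcongr
          linarith [show 0 ≤ 4 * B / weight R by positivity]
  · have h4 : |secondDiff w x z| ≤ 4 * B := by
      have a1 := abs_le.1 (hwM (x + z))
      have a2 := abs_le.1 (hwM (x - z))
      have a3 := abs_le.1 (hwM x)
      rw [abs_le, secondDiff]
      constructor <;> linarith
    calc |secondDiff w x z| ≤ 4 * B := h4
      _ = 4 * B / weight R * weight R := by field_simp
      _ ≤ 4 * B / weight R * weight ‖z‖ := by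
          gcongr
          exact weight_mono hR.le hz
      _ ≤ (C + 4 * B / weight R) * weight ‖z‖ := by
          gcongr
          linarith

/-! ### The penalty functions -/

section Penalties

variable {E : Type*} [NormedAddCommGroup E]

/-- A smooth approximation of the norm from above: `√(δ² + |z|²)`. -/
noncomputable def smoothNorm (δ : ℝ) (z : E) : ℝ := √(δ ^ 2 + ‖z‖ ^ 2)

/-- The localising penalty `(1 + |x|²)^(1/4)`. It tends to infinity, but slowly enough for the
operator of order one to be finite and bounded on it. -/
noncomputable def growth (x : E) : ℝ := √(smoothNorm 1 x)

lemma norm_le_smoothNorm (δ : ℝ) (z : E) : ‖z‖ ≤ smoothNorm δ z :=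
  Real.le_sqrt_of_sq_le (by nlinarith [sq_nonneg δ])

lemma smoothNorm_le {δ : ℝ} (hδ : 0 ≤ δ) (z : E) : smoothNorm δ z ≤ ‖z‖ + δ :=
  Real.sqrt_le_iff.2 ⟨by positivity, by nlinarith [mul_nonneg hδ (norm_nonneg z)]⟩

lemma smoothNorm_sq (δ : ℝ) (z : E) : smoothNorm δ z ^ 2 = δ ^ 2 + ‖z‖ ^ 2 :=
  Real.sq_sqrt (by positivity)

lemma smoothNorm_nonneg (δ : ℝ) (z : E) : 0 ≤ smoothNorm δ z := Real.sqrt_nonneg _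

lemma le_smoothNorm (δ : ℝ) (z : E) : δ ≤ smoothNorm δ z :=
  Real.le_sqrt_of_sq_le (by nlinarith [sq_nonneg ‖z‖])

lemma one_le_growth (x : E) : 1 ≤ growth x := by
  unfold growth
  exact Real.one_le_sqrt.2 (le_smoothNorm 1 x)

lemma growth_sq (x : E) : growth x ^ 2 = smoothNorm 1 x := Real.sq_sqrt (smoothNorm_nonneg _ _)

lemma sqrt_norm_le_growth (x : E) : √‖x‖ ≤ growth x :=
  Real.sqrt_le_sqrt (norm_le_smoothNorm 1 x)

variable [InnerProductSpace ℝ E]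

lemma contDiff_smoothNorm {δ : ℝ} (hδ : 0 < δ) : ContDiff ℝ 2 (smoothNorm δ : E → ℝ) := by
  unfold smoothNorm
  exact (contDiff_const.add (contDiff_norm_sq ℝ)).sqrt fun z => by positivity

lemma smoothNorm_add_le (δ : ℝ) (x z : E) :
    smoothNorm δ (x + z) ≤ smoothNorm δ x + ‖z‖ := by
  have h0 := smoothNorm_nonneg δ x
  refine Real.sqrt_le_iff.2 ⟨by positivity, ?_⟩
  have h1 := smoothNorm_sq δ x
  have h2 := norm_add_sq_real x z
  have h3 : inner ℝ x z ≤ smoothNorm δ x * ‖z‖ :=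
    (real_inner_le_norm x z).trans
      (mul_le_mul_of_nonneg_right (norm_le_smoothNorm δ x) (norm_nonneg z))
  nlinarith

lemma secondDiff_smoothNorm_le {δ : ℝ} (hδ : 0 < δ) (x z : E) :
    secondDiff (smoothNorm δ) x z ≤ ‖z‖ ^ 2 / δ := by
  have hp := smoothNorm_sq δ (x + z)
  have hm := smoothNorm_sq δ (x - z)
  have h0 := smoothNorm_sq δ x
  have e1 := norm_add_sq_real x z
  have e2 := norm_sub_sq_real x z
  have hd := le_smoothNorm δ x
  set p := smoothNorm δ (x + z)
  set m := smoothNorm δ (x - z)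
  set q := smoothNorm δ x
  have hq : 0 < q := hδ.trans_le hd
  -- Each square root is below its tangent line at `q²`, and the two increments add to `2|z|²`.
  have : p + m - 2 * q ≤ ‖z‖ ^ 2 / q := by
    rw [le_div_iff₀ hq]
    nlinarith [sq_nonneg (p - q), sq_nonneg (m - q)]
  exact this.trans (by gcongr)

lemma contDiff_growth : ContDiff ℝ 2 (growth : E → ℝ) := by
  unfold growth
  exact (contDiff_smoothNorm one_pos).sqrt fun z => (one_pos.trans_le (le_smoothNorm 1 z)).ne'

lemma growth_add_le_add_sqrt (x z : E) : growth (x + z) ≤ growth x + √‖z‖ := by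
  have h0 := one_le_growth x
  have h2 : √‖z‖ ^ 2 = ‖z‖ := Real.sq_sqrt (norm_nonneg z)
  have h3 := Real.sqrt_nonneg ‖z‖
  refine Real.sqrt_le_iff.2 ⟨by positivity, ?_⟩
  nlinarith [smoothNorm_add_le 1 x z, growth_sq x]

lemma growth_add_le_add_norm (x z : E) : growth (x + z) ≤ growth x + ‖z‖ := by
  have h0 := one_le_growth x
  have h3 := norm_nonneg z
  refine Real.sqrt_le_iff.2 ⟨by positivity, ?_⟩
  nlinarith [smoothNorm_add_le 1 x z, growth_sq x]

lemma norm_fderiv_growth_le (x : E) : ‖fderiv ℝ (growth : E → ℝ) x‖ ≤ 1 := by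
  have : LipschitzWith 1 (growth : E → ℝ) := LipschitzWith.of_le_add fun x y => by
    have := growth_add_le_add_norm y (x - y)
    rwa [add_sub_cancel, ← dist_eq_norm] at this
  simpa using norm_fderiv_le_of_lipschitz ℝ (x₀ := x) this

lemma secondDiff_growth_le (x z : E) : secondDiff growth x z ≤ 2 * weight ‖z‖ := by
  rcases le_total ‖z‖ 1 with hz | hz
  · have h1 := secondDiff_smoothNorm_le one_pos x z
    have h2 := sq_le_weight (norm_nonneg z) hz
    have gp := growth_sq (x + z)
    have gm := growth_sq (x - z)
    have g0 := growth_sq x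
    have h0 := one_le_growth x
    have hw := weight_nonneg (norm_nonneg z)
    unfold secondDiff at h1 ⊢
    rw [div_one, ← gp, ← gm, ← g0] at h1
    set p := growth (x + z)
    set m := growth (x - z)
    set q := growth x
    have : (p + m - 2 * q) * q ≤ ‖z‖ ^ 2 := by
      nlinarith [sq_nonneg (p - q), sq_nonneg (m - q), sq_nonneg ‖z‖]
    by_contra! hcon
    nlinarith
  · have h1 := growth_add_le_add_sqrt x z
    have h2 := growth_add_le_add_sqrt x (-z)
    rw [norm_neg, ← sub_eq_add_neg] at h2
    rw [← sqrt_eq_weight hz]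
    unfold secondDiff
    linarith

end Penalties

/-! ### Comparison of values of the Isaacs operator -/

lemma iSup_iInf_le_add {ι κ : Type*} {f g : ι → κ → ℝ} {d : ℝ} (h : ∀ i j, f i j ≤ g i j + d) :
    (⨆ i, ⨅ j, (f i j : EReal)) ≤ (⨆ i, ⨅ j, (g i j : EReal)) + d := by
  refine iSup_le fun i => ?_
  refine le_trans ?_ (add_le_add_left (le_iSup (fun i => ⨅ j, (g i j : EReal)) i) _)
  rw [← EReal.sub_le_iff_le_add (by simp) (by simp)]
  refine le_iInf fun j => ?_
  rw [EReal.sub_le_iff_le_add (by simp) (by simp)]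
  exact (iInf_le _ j).trans (by exact_mod_cast h i j)

lemma nonlocalOp_le_add {n : ℕ} [NeZero n] {a w₁ w₂ : EuclideanSpace ℝ (Fin n) → ℝ}
    {x₁ x₂ : EuclideanSpace ℝ (Fin n)} {lam Lam D : ℝ}
    (ha_meas : AEMeasurable a volume) (ha_symm : ∀ y, a y = a (-y))
    (ha_ell : ∀ y, lam ≤ a y ∧ a y ≤ Lam) (hlam : 0 < lam)
    (hw₁ : Measurable w₁) (hM₁ : ∃ M, ∀ y, |w₁ y| ≤ M)
    (hC₁ : ∃ C, ∀ z, |secondDiff w₁ x₁ z| ≤ C * weight ‖z‖)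
    (hw₂ : Measurable w₂) (hM₂ : ∃ M, ∀ y, |w₂ y| ≤ M)
    (hC₂ : ∃ C, ∀ z, |secondDiff w₂ x₂ z| ≤ C * weight ‖z‖) (hD : 0 ≤ D)
    (h : ∀ z, secondDiff w₁ x₁ z - secondDiff w₂ x₂ z ≤ 2 * D * weight ‖z‖) :
    nonlocalOp a w₁ x₁ ≤ nonlocalOp a w₂ x₂ +
      Lam * D * ∫ z : EuclideanSpace ℝ (Fin n), weight ‖z‖ / ‖z‖ ^ (n + 1) := by
  obtain ⟨M₁, hM₁⟩ := hM₁
  obtain ⟨C₁, hC₁⟩ := hC₁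
  obtain ⟨M₂, hM₂⟩ := hM₂
  obtain ⟨C₂, hC₂⟩ := hC₂
  have hint : ∀ {w : EuclideanSpace ℝ (Fin n) → ℝ} {x : EuclideanSpace ℝ (Fin n)} {C : ℝ},
      Measurable w → (∀ z, |secondDiff w x z| ≤ C * weight ‖z‖) →
      Integrable fun z => (secondDiff w x z / 2) / ‖z‖ ^ (n + 1) * a z := by
    intro w x C hw hC
    refine integrable_kernel (C := C) ha_ell hlam ha_meas
      ((measurable_secondDiff hw).div_const 2) fun z => ?_
    rw [abs_div, abs_two]
    linarith [hC z, abs_nonneg (secondDiff w x z)]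
  rw [nonlocalOp_eq ha_meas ha_symm ha_ell hlam hw₁ hM₁ hC₁,
    nonlocalOp_eq ha_meas ha_symm ha_ell hlam hw₂ hM₂ hC₂, ← integral_const_mul,
    ← integral_add (hint hw₂ hC₂) ((integrable_weight n).const_mul _)]
  refine integral_mono (hint hw₁ hC₁)
    ((hint hw₂ hC₂).add ((integrable_weight n).const_mul _)) fun z => ?_
  have ha0 : 0 ≤ a z := hlam.le.trans (ha_ell z).1
  have hw0 := weight_nonneg (norm_nonneg z)
  have h1 : (secondDiff w₁ x₁ z - secondDiff w₂ x₂ z) / 2 / ‖z‖ ^ (n + 1) * a z ≤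
      D * weight ‖z‖ / ‖z‖ ^ (n + 1) * a z := by
    gcongr
    linarith [h z]
  have h2 : D * weight ‖z‖ / ‖z‖ ^ (n + 1) * a z ≤ D * weight ‖z‖ / ‖z‖ ^ (n + 1) * Lam := by
    gcongr
    exact (ha_ell z).2
  have e1 : (secondDiff w₁ x₁ z - secondDiff w₂ x₂ z) / 2 / ‖z‖ ^ (n + 1) * a z =
      secondDiff w₁ x₁ z / 2 / ‖z‖ ^ (n + 1) * a z -
        secondDiff w₂ x₂ z / 2 / ‖z‖ ^ (n + 1) * a z := by ring
  have e2 : D * weight ‖z‖ / ‖z‖ ^ (n + 1) * Lam = Lam * D * (weight ‖z‖ / ‖z‖ ^ (n + 1)) := by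
    ring
  beta_reduce
  linarith

lemma inner_gradient_eq {n : ℕ} (v x : EuclideanSpace ℝ (Fin n)) (w : EuclideanSpace ℝ (Fin n) → ℝ) :
    inner ℝ v (gradient w x) = fderiv ℝ w x v := by
  rw [real_inner_comm, inner_gradient_left]

/-! ### The doubled function and its interior maxima -/

/-- The difference `u x t - u y s` in doubled variables, penalised by a smooth multiple of the
distance `|x - y|`, by a localising term in `x`, by the distance of the two times, and by a term
linear in time that makes the inequality strict. -/
noncomputable def doubled (u : EuclideanSpace ℝ (Fin n) → ℝ → ℝ) (K δ β ε η : ℝ)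
    (x y : EuclideanSpace ℝ (Fin n)) (t s : ℝ) : ℝ :=
  u x t - u y s - K * smoothNorm δ (x - y) - β * growth x - (t - s) ^ 2 / (2 * ε) - η * t

lemma hasDerivAt_sq_div {s t ε : ℝ} (hε : ε ≠ 0) :
    HasDerivAt (fun q : ℝ => (q - s) ^ 2 / (2 * ε)) ((t - s) / ε) t := by
  have := (((hasDerivAt_id t).sub_const s).pow 2).div_const (2 * ε)
  refine this.congr_deriv ?_
  simp only [id_eq, Nat.cast_ofNat, Nat.add_one_sub_one, pow_one, mul_one]
  field_simp

/-- At a maximum of the doubled function at positive times, the equation bounds the slope `η` of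
the time penalty by errors coming from the localisation (`β`) and from the ball of radius `r`
in which the test functions replace the solution. -/
lemma slope_le_of_isMax {n : ℕ} [NeZero n] {ι κ : Type*} {lam Lam : ℝ} (hlam : 0 < lam)
    {c : ι → κ → ℝ} {b : ι → κ → EuclideanSpace ℝ (Fin n)} {A : ℝ} (hb : ∀ i j, ‖b i j‖ ≤ A)
    {a : ι → κ → EuclideanSpace ℝ (Fin n) → ℝ}
    (ha_meas : ∀ i j, AEMeasurable (a i j) volume)
    (ha_symm : ∀ i j y, a i j y = a i j (-y))
    (ha_ell : ∀ i j y, lam ≤ a i j y ∧ a i j y ≤ Lam)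
    {u : EuclideanSpace ℝ (Fin n) → ℝ → ℝ} (hu : IsViscositySolution c b a u)
    {M : ℝ} (hM : ∀ x t, 0 ≤ t → |u x t| ≤ M)
    {K δ β ε η T r : ℝ} (hK : 0 ≤ K) (hδ : 0 < δ) (hβ : 0 ≤ β) (hε : 0 < ε)
    (hr : 0 < r) (hr1 : r ≤ 1)
    {x₀ y₀ : EuclideanSpace ℝ (Fin n)} {t₀ s₀ : ℝ} (ht₀ : 0 < t₀) (ht₀T : t₀ ≤ T)
    (hs₀ : 0 < s₀) (hs₀T : s₀ ≤ T)
    (hmax : ∀ x y t s, 0 ≤ t → t ≤ T → 0 ≤ s → s ≤ T →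
      doubled u K δ β ε η x y t s ≤ doubled u K δ β ε η x₀ y₀ t₀ s₀) :
    η ≤ A * β + Lam * (K / δ * √r + β) *
      ∫ z : EuclideanSpace ℝ (Fin n), weight ‖z‖ / ‖z‖ ^ (n + 1) := by
  classical
  have hcont : ∀ t, 0 ≤ t → Continuous fun y => u y t := fun t ht =>
    hu.continuousOn.comp_continuous (by fun_prop : Continuous fun y => (y, t))
      fun y => ⟨trivial, ht⟩
  set m := doubled u K δ β ε η x₀ y₀ t₀ s₀ with hm
  set φ : EuclideanSpace ℝ (Fin n) × ℝ → ℝ := fun p =>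
    u y₀ s₀ + m + K * smoothNorm δ (p.1 - y₀) + β * growth p.1 + (p.2 - s₀) ^ 2 / (2 * ε)
      + η * p.2 with hφ
  set ψ : EuclideanSpace ℝ (Fin n) × ℝ → ℝ := fun p =>
    u x₀ t₀ - m - K * smoothNorm δ (x₀ - p.1) - β * growth x₀ - (p.2 - t₀) ^ 2 / (2 * ε)
      - η * t₀ with hψ
  have hN := contDiff_smoothNorm (E := EuclideanSpace ℝ (Fin n)) hδ
  have hG := contDiff_growth (E := EuclideanSpace ℝ (Fin n))
  have hφ2 : ContDiff ℝ 2 φ := by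
    have h1 : ContDiff ℝ 2 fun p : EuclideanSpace ℝ (Fin n) × ℝ => smoothNorm δ (p.1 - y₀) :=
      hN.comp (contDiff_fst.sub contDiff_const)
    have h2 : ContDiff ℝ 2 fun p : EuclideanSpace ℝ (Fin n) × ℝ => growth p.1 :=
      hG.comp contDiff_fst
    fun_prop
  have hψ2 : ContDiff ℝ 2 ψ := by
    have h1 : ContDiff ℝ 2 fun p : EuclideanSpace ℝ (Fin n) × ℝ => smoothNorm δ (x₀ - p.1) :=
      hN.comp (contDiff_const.sub contDiff_fst)
    fun_prop
  have hφtouch : TouchesFromAbove φ u x₀ t₀ r := by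
    refine ⟨by simp only [hφ, hm, doubled]; ring, fun y s _ _ hs hs0 => ?_⟩
    have := hmax y y₀ s s₀ hs0 (hs.trans ht₀T) hs₀.le hs₀T
    rw [doubled] at this
    simp only [hφ]
    linarith
  have hψtouch : TouchesFromBelow ψ u y₀ s₀ r := by
    refine ⟨by simp only [hψ, hm, doubled]; ring, fun y s _ _ hs hs0 => ?_⟩
    have := hmax x₀ y t₀ s ht₀.le ht₀T hs0 (hs.trans hs₀T)
    rw [doubled, ← neg_sub s t₀, neg_sq] at this
    simp only [hψ]
    linarith
  have hsub := hu.sub.test φ x₀ t₀ r hφ2 ht₀ hr hφtouch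
  have hsup := hu.super.test ψ y₀ s₀ r hψ2 hs₀ hr hψtouch
  have htmem : t₀ ∈ Set.Ioo (t₀ - r) (t₀ + r) := ⟨by linarith, by linarith⟩
  have hsmem : s₀ ∈ Set.Ioo (s₀ - r) (s₀ + r) := ⟨by linarith, by linarith⟩
  have hd₁ : deriv (fun s => patch φ u x₀ t₀ r x₀ s) t₀ = (t₀ - s₀) / ε + η := by
    have : (fun s => patch φ u x₀ t₀ r x₀ s) =ᶠ[𝓝 t₀] fun s => φ (x₀, s) := by
      filter_upwards [isOpen_Ioo.mem_nhds htmem] with s hs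
      simp only [patch]
      rw [if_pos ⟨Metric.mem_ball_self hr, hs⟩]
    rw [this.deriv_eq]
    have := ((hasDerivAt_sq_div (s := s₀) (t := t₀) hε.ne').const_add
      (u y₀ s₀ + m + K * smoothNorm δ (x₀ - y₀) + β * growth x₀)).add
      ((hasDerivAt_id t₀).const_mul η)
    rw [mul_one] at this
    exact this.deriv
  have hd₂ : deriv (fun s => patch ψ u y₀ s₀ r y₀ s) s₀ = (t₀ - s₀) / ε := by
    have : (fun s => patch ψ u y₀ s₀ r y₀ s) =ᶠ[𝓝 s₀] fun s => ψ (y₀, s) := by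
      filter_upwards [isOpen_Ioo.mem_nhds hsmem] with s hs
      simp only [patch]
      rw [if_pos ⟨Metric.mem_ball_self hr, hs⟩]
    rw [this.deriv_eq]
    have := ((hasDerivAt_sq_div (s := t₀) (t := s₀) hε.ne').const_sub
      (u x₀ t₀ - m - K * smoothNorm δ (x₀ - y₀) - β * growth x₀)).sub_const (η * t₀)
    rw [this.deriv]
    ring
  set w₁ : EuclideanSpace ℝ (Fin n) → ℝ :=
    fun y => if y ∈ Metric.ball x₀ r then φ (y, t₀) else u y t₀ with hw₁
  set w₂ : EuclideanSpace ℝ (Fin n) → ℝ :=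
    fun y => if y ∈ Metric.ball y₀ r then ψ (y, s₀) else u y s₀ with hw₂
  have hp₁ : (fun y => patch φ u x₀ t₀ r y t₀) = w₁ := by
    funext y
    simp only [patch, htmem, and_true, hw₁]
  have hp₂ : (fun y => patch ψ u y₀ s₀ r y s₀) = w₂ := by
    funext y
    simp only [patch, hsmem, and_true, hw₂]
  rw [hd₁, hp₁] at hsub
  rw [hd₂, hp₂] at hsup
  obtain ⟨h1m, h1M, h1C⟩ := patched_bounds (f := fun y => φ (y, t₀)) (x := x₀) (r := r)
    (by fun_prop) (hcont t₀ ht₀.le) (fun y => hM y t₀ ht₀.le) hr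
  obtain ⟨h2m, h2M, h2C⟩ := patched_bounds (f := fun y => ψ (y, s₀)) (x := y₀) (r := r)
    (by fun_prop) (hcont s₀ hs₀.le) (fun y => hM y s₀ hs₀.le) hr
  -- The two gradients differ only by the gradient of the localising term.
  have hgrad : ∀ v, fderiv ℝ w₁ x₀ v = fderiv ℝ w₂ y₀ v + β * fderiv ℝ growth x₀ v := by
    intro v
    have e1 : w₁ =ᶠ[𝓝 x₀] fun y => φ (y, t₀) := by
      filter_upwards [Metric.ball_mem_nhds x₀ hr] with y hy
      simp only [hw₁, if_pos hy]
    have e2 : w₂ =ᶠ[𝓝 y₀] fun y => ψ (y, s₀) := by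
      filter_upwards [Metric.ball_mem_nhds y₀ hr] with y hy
      simp only [hw₂, if_pos hy]
    have hNd : HasFDerivAt (smoothNorm δ) (fderiv ℝ (smoothNorm δ) (x₀ - y₀)) (x₀ - y₀) :=
      (hN.differentiable (by norm_num) _).hasFDerivAt
    have hGd : HasFDerivAt growth (fderiv ℝ growth x₀) x₀ :=
      (hG.differentiable (by norm_num) _).hasFDerivAt
    have f1 : HasFDerivAt (fun y => φ (y, t₀))
        (K • (fderiv ℝ (smoothNorm δ) (x₀ - y₀)).comp
          (ContinuousLinearMap.id ℝ (EuclideanSpace ℝ (Fin n))) + β • fderiv ℝ growth x₀) x₀ :=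
      ((((hNd.comp x₀ ((hasFDerivAt_id x₀).sub_const y₀)).const_mul K).const_add
        (u y₀ s₀ + m)).add (hGd.const_mul β)).add_const ((t₀ - s₀) ^ 2 / (2 * ε))
          |>.add_const (η * t₀)
    have f2 : HasFDerivAt (fun y => ψ (y, s₀))
        (-(K • (fderiv ℝ (smoothNorm δ) (x₀ - y₀)).comp
          (-ContinuousLinearMap.id ℝ (EuclideanSpace ℝ (Fin n))))) y₀ :=
      ((((hNd.comp y₀ ((hasFDerivAt_id y₀).const_sub x₀)).const_mul K).const_sub
        (u x₀ t₀ - m)).sub_const (β * growth x₀)).sub_const ((s₀ - t₀) ^ 2 / (2 * ε))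
          |>.sub_const (η * t₀)
    rw [e1.fderiv_eq, e2.fderiv_eq, f1.fderiv, f2.fderiv]
    simp
  have hsd : ∀ z, secondDiff w₁ x₀ z - secondDiff w₂ y₀ z ≤
      2 * (K / δ * √r + β) * weight ‖z‖ := by
    intro z
    have hG' : β * secondDiff growth x₀ z ≤ β * (2 * weight ‖z‖) :=
      mul_le_mul_of_nonneg_left (secondDiff_growth_le x₀ z) hβ
    have hw0 := weight_nonneg (norm_nonneg z)
    have hcomm : ∀ v, (x₀ + v) - (y₀ + v) = x₀ - y₀ := fun v => by abel
    have hx0 : w₁ x₀ = u x₀ t₀ := by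
      simp only [hw₁, if_pos (Metric.mem_ball_self hr)]
      exact hφtouch.1
    have hy0 : w₂ y₀ = u y₀ s₀ := by
      simp only [hw₂, if_pos (Metric.mem_ball_self hr)]
      exact hψtouch.1
    rcases lt_or_ge ‖z‖ r with hz | hz
    · -- Inside the ball the second differences of the distance penalty add up.
      have hN' : K * secondDiff (smoothNorm δ) (x₀ - y₀) z ≤ K / δ * (√r * weight ‖z‖) := by
        calc K * secondDiff (smoothNorm δ) (x₀ - y₀) z ≤ K * (‖z‖ ^ 2 / δ) := by
              gcongr
              exact secondDiff_smoothNorm_le hδ _ _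
          _ = K / δ * ‖z‖ ^ 2 := by ring
          _ ≤ _ := by
              gcongr
              exact sq_le_sqrt_mul_weight (norm_nonneg z) hz.le (hz.le.trans hr1)
      have m1 : x₀ + z ∈ Metric.ball x₀ r := by simpa using hz
      have m2 : x₀ - z ∈ Metric.ball x₀ r := by simpa [sub_eq_add_neg] using hz
      have m3 : y₀ + z ∈ Metric.ball y₀ r := by simpa using hz
      have m4 : y₀ - z ∈ Metric.ball y₀ r := by simpa [sub_eq_add_neg] using hz
      have : secondDiff w₁ x₀ z - secondDiff w₂ y₀ z =
          2 * (K * secondDiff (smoothNorm δ) (x₀ - y₀) z) + β * secondDiff growth x₀ z := by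
        simp only [secondDiff, hw₁, hw₂, if_pos m1, if_pos m2, if_pos m3, if_pos m4,
          if_pos (Metric.mem_ball_self hr), hφ, hψ,
          show x₀ + z - y₀ = x₀ - y₀ + z by abel, show x₀ - z - y₀ = x₀ - y₀ - z by abel,
          show x₀ - (y₀ + z) = x₀ - y₀ - z by abel, show x₀ - (y₀ - z) = x₀ - y₀ + z by abel]
        ring
      rw [this]
      linarith
    · -- Outside the ball translating both points by `z` leaves the distance penalty unchanged.
      have m1 : x₀ + z ∉ Metric.ball x₀ r := by simpa using hz
      have m2 : x₀ - z ∉ Metric.ball x₀ r := by simpa [sub_eq_add_neg] using hz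
      have m3 : y₀ + z ∉ Metric.ball y₀ r := by simpa using hz
      have m4 : y₀ - z ∉ Metric.ball y₀ r := by simpa [sub_eq_add_neg] using hz
      have g1 := hmax (x₀ + z) (y₀ + z) t₀ s₀ ht₀.le ht₀T hs₀.le hs₀T
      have g2 := hmax (x₀ - z) (y₀ - z) t₀ s₀ ht₀.le ht₀T hs₀.le hs₀T
      rw [hm, doubled, doubled] at g1 g2
      rw [add_sub_add_right_eq_sub] at g1
      rw [sub_sub_sub_cancel_right] at g2
      have h0 : 0 ≤ K / δ * √r * weight ‖z‖ := by positivity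
      unfold secondDiff at hG' ⊢
      rw [hx0, hy0]
      simp only [hw₁, hw₂, if_neg m1, if_neg m2, if_neg m3, if_neg m4]
      linarith
  set d := A * β + Lam * (K / δ * √r + β) *
      ∫ z : EuclideanSpace ℝ (Fin n), weight ‖z‖ / ‖z‖ ^ (n + 1) with hd
  have hop : isaacsOp c b a w₁ x₀ ≤ isaacsOp c b a w₂ y₀ + d := by
    refine iSup_iInf_le_add fun i j => ?_
    have h1 := nonlocalOp_le_add (ha_meas i j) (ha_symm i j) (ha_ell i j) hlam h1m h1M h1C
      h2m h2M h2C (by positivity) hsd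
    have h2 : fderiv ℝ growth x₀ (b i j) ≤ A := by
      refine (le_abs_self _).trans (((fderiv ℝ growth x₀).le_opNorm (b i j)).trans ?_)
      have := mul_le_mul (norm_fderiv_growth_le x₀) (hb i j) (norm_nonneg _) zero_le_one
      rwa [one_mul] at this
    have h3 := mul_le_mul_of_nonneg_left h2 hβ
    rw [inner_gradient_eq, inner_gradient_eq, hgrad, hd]
    linarith
  have := hsub.trans (hop.trans (add_le_add_left hsup _))
  have h' : (t₀ - s₀) / ε + η ≤ (t₀ - s₀) / ε + d := by exact_mod_cast this
  linarith

/-! ### Existence of the maximum and conclusion -/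

/-- Boundedness of `u` confines the points where the doubled function is positive to a compact set
independent of `ε`, and makes the two times close. -/
lemma norm_le_of_doubled_pos {n : ℕ} {u : EuclideanSpace ℝ (Fin n) → ℝ → ℝ} {M : ℝ}
    (hM : ∀ x t, 0 ≤ t → |u x t| ≤ M) {K δ β ε η : ℝ} (hK : 0 < K) (hβ : 0 < β) (hε : 0 < ε)
    (hη : 0 ≤ η) {x y : EuclideanSpace ℝ (Fin n)} {t s : ℝ} (ht : 0 ≤ t) (hs : 0 ≤ s)
    (h : 0 < doubled u K δ β ε η x y t s) :
    ‖x‖ ≤ (2 * M / β) ^ 2 + 2 * M / K ∧ ‖y‖ ≤ (2 * M / β) ^ 2 + 2 * M / K ∧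
      (t - s) ^ 2 ≤ 4 * M * ε := by
  have hx := abs_le.1 (hM x t ht)
  have hy := abs_le.1 (hM y s hs)
  have h1 : K * ‖x - y‖ ≤ K * smoothNorm δ (x - y) := by
    gcongr
    exact norm_le_smoothNorm _ _
  have h2 : β * √‖x‖ ≤ β * growth x := by
    gcongr
    exact sqrt_norm_le_growth x
  have h1' : 0 ≤ K * ‖x - y‖ := by positivity
  have h2' : 0 ≤ β * √‖x‖ := by positivity
  have h3 : 0 ≤ (t - s) ^ 2 / (2 * ε) := by positivity
  have h4 : 0 ≤ η * t := by positivity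
  unfold doubled at h
  have e1 : ‖x - y‖ ≤ 2 * M / K := by
    rw [le_div_iff₀ hK, mul_comm]; linarith
  have e2 : √‖x‖ ≤ 2 * M / β := by
    rw [le_div_iff₀ hβ, mul_comm]; linarith
  have e3 : ‖x‖ ≤ (2 * M / β) ^ 2 := (Real.sqrt_le_iff.1 e2).2
  have e4 : (t - s) ^ 2 / (2 * ε) ≤ 2 * M := by linarith
  rw [div_le_iff₀ (by positivity)] at e4
  have e5 : ‖y‖ ≤ ‖x‖ + ‖x - y‖ := by
    rw [norm_sub_rev]
    exact norm_le_norm_add_norm_sub' y x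
  have := norm_nonneg (x - y)
  exact ⟨by linarith, by linarith, by linarith⟩

lemma exists_isMax_doubled {n : ℕ} {u : EuclideanSpace ℝ (Fin n) → ℝ → ℝ}
    (hu : ContinuousOn (fun p : EuclideanSpace ℝ (Fin n) × ℝ => u p.1 p.2)
      (Set.univ ×ˢ Set.Ici 0))
    {M : ℝ} (hM : ∀ x t, 0 ≤ t → |u x t| ≤ M) {K δ β ε η T : ℝ} (hK : 0 < K) (hδ : 0 < δ)
    (hβ : 0 < β) (hε : 0 < ε) (hη : 0 ≤ η) {x₁ y₁ : EuclideanSpace ℝ (Fin n)} {t₁ s₁ : ℝ}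
    (ht₁ : t₁ ∈ Set.Icc 0 T) (hs₁ : s₁ ∈ Set.Icc 0 T)
    (hpos : 0 < doubled u K δ β ε η x₁ y₁ t₁ s₁) :
    ∃ x₀ y₀ t₀ s₀, t₀ ∈ Set.Icc 0 T ∧ s₀ ∈ Set.Icc 0 T ∧
      ∀ x y t s, 0 ≤ t → t ≤ T → 0 ≤ s → s ≤ T →
        doubled u K δ β ε η x y t s ≤ doubled u K δ β ε η x₀ y₀ t₀ s₀ := by
  set R := (2 * M / β) ^ 2 + 2 * M / K
  set B := Metric.closedBall (0 : EuclideanSpace ℝ (Fin n)) R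
  set S := B ×ˢ B ×ˢ Set.Icc (0 : ℝ) T ×ˢ Set.Icc (0 : ℝ) T
  have hS : IsCompact S := (isCompact_closedBall _ _).prod
    ((isCompact_closedBall _ _).prod (isCompact_Icc.prod isCompact_Icc))
  have hmem : ∀ x y t s, t ∈ Set.Icc 0 T → s ∈ Set.Icc 0 T →
      0 < doubled u K δ β ε η x y t s → (x, y, t, s) ∈ S := by
    intro x y t s ht hs h
    obtain ⟨h1, h2, -⟩ := norm_le_of_doubled_pos hM hK hβ hε hη ht.1 hs.1 h
    exact ⟨by simpa [B] using h1, by simpa [B] using h2, ht, hs⟩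
  have hcont : ContinuousOn (fun p : EuclideanSpace ℝ (Fin n) × EuclideanSpace ℝ (Fin n) × ℝ × ℝ =>
      doubled u K δ β ε η p.1 p.2.1 p.2.2.1 p.2.2.2) S := by
    have c1 : ContinuousOn (fun p : EuclideanSpace ℝ (Fin n) × EuclideanSpace ℝ (Fin n) × ℝ × ℝ =>
        u p.1 p.2.2.1) S :=
      hu.comp (f := fun p : EuclideanSpace ℝ (Fin n) × EuclideanSpace ℝ (Fin n) × ℝ × ℝ =>
        (p.1, p.2.2.1)) (by fun_prop) fun p hp => ⟨trivial, hp.2.2.1.1⟩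
    have c2 : ContinuousOn (fun p : EuclideanSpace ℝ (Fin n) × EuclideanSpace ℝ (Fin n) × ℝ × ℝ =>
        u p.2.1 p.2.2.2) S :=
      hu.comp (f := fun p : EuclideanSpace ℝ (Fin n) × EuclideanSpace ℝ (Fin n) × ℝ × ℝ =>
        (p.2.1, p.2.2.2)) (by fun_prop) fun p hp => ⟨trivial, hp.2.2.2.1⟩
    have c3 : Continuous (smoothNorm δ : EuclideanSpace ℝ (Fin n) → ℝ) :=
      (contDiff_smoothNorm hδ).continuous
    have c4 : Continuous (growth : EuclideanSpace ℝ (Fin n) → ℝ) := contDiff_growth.continuous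
    have c5 : Continuous fun p : EuclideanSpace ℝ (Fin n) × EuclideanSpace ℝ (Fin n) × ℝ × ℝ =>
        K * smoothNorm δ (p.1 - p.2.1) + β * growth p.1 + (p.2.2.1 - p.2.2.2) ^ 2 / (2 * ε) +
          η * p.2.2.1 := by fun_prop
    refine ((c1.sub c2).sub c5.continuousOn).congr fun p _ => ?_
    simp only [doubled, Pi.sub_apply]
    ring
  obtain ⟨⟨x₀, y₀, t₀, s₀⟩, hp, hmax⟩ := hS.exists_isMaxOn
    ⟨_, hmem x₁ y₁ t₁ s₁ ht₁ hs₁ hpos⟩ hcont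
  refine ⟨x₀, y₀, t₀, s₀, hp.2.2.1, hp.2.2.2, fun x y t s ht htT hs hsT => ?_⟩
  rcases le_or_gt (doubled u K δ β ε η x y t s) 0 with h | h
  · exact h.trans (hpos.le.trans (hmax (hmem x₁ y₁ t₁ s₁ ht₁ hs₁ hpos)))
  · exact hmax (hmem x y t s ⟨ht, htT⟩ ⟨hs, hsT⟩ h)

lemma exists_pos_mul_le (Q : ℝ) {e : ℝ} (he : 0 < e) : ∃ q > 0, q ≤ 1 ∧ ∀ p, 0 ≤ p → p ≤ q →
    Q * p < e := by
  refine ⟨min 1 (e / (|Q| + 1)), by positivity, min_le_left _ _, fun p hp hpq => ?_⟩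
  have h1 : p ≤ e / (|Q| + 1) := hpq.trans (min_le_right _ _)
  rw [le_div_iff₀ (by positivity)] at h1
  rcases hp.eq_or_lt with rfl | hp
  · simpa using he
  · nlinarith [le_abs_self Q]

/-- The modulus of continuity `K · √(δ² + |x - y|²)`, with `K` larger than the Lipschitz constant
at time zero, is preserved by the flow. -/
lemma sub_le_mul_smoothNorm {n : ℕ} [NeZero n] {ι κ : Type*} {lam Lam : ℝ} (hlam : 0 < lam)
    {c : ι → κ → ℝ} {b : ι → κ → EuclideanSpace ℝ (Fin n)} {A : ℝ} (hb : ∀ i j, ‖b i j‖ ≤ A)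
    {a : ι → κ → EuclideanSpace ℝ (Fin n) → ℝ}
    (ha_meas : ∀ i j, AEMeasurable (a i j) volume)
    (ha_symm : ∀ i j y, a i j y = a i j (-y))
    (ha_ell : ∀ i j y, lam ≤ a i j y ∧ a i j y ≤ Lam)
    {u : EuclideanSpace ℝ (Fin n) → ℝ → ℝ} (hu : IsViscositySolution c b a u)
    {M : ℝ} (hM : ∀ x t, 0 ≤ t → |u x t| ≤ M) {K δ T : ℝ} (hK : 0 < K) (hδ : 0 < δ)
    (h0 : ∀ x y, u x 0 - u y 0 ≤ K * ‖x - y‖) (hT : 0 ≤ T)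
    (x y : EuclideanSpace ℝ (Fin n)) :
    u x T - u y T ≤ K * smoothNorm δ (x - y) := by
  by_contra! hcon
  have hM0 : 0 ≤ M := (abs_nonneg _).trans (hM x T hT)
  set σ := (u x T - u y T - K * smoothNorm δ (x - y)) / 2 with hσ
  have hσ0 : 0 < σ := by rw [hσ]; linarith
  set J := ∫ z : EuclideanSpace ℝ (Fin n), weight ‖z‖ / ‖z‖ ^ (n + 1)
  -- Choice of parameters: first the slope `η`, then `β`, then `ε`, and `r` only after the maximum.
  obtain ⟨η, hη, -, hηT⟩ := exists_pos_mul_le T (half_pos hσ0)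
  replace hηT := hηT η hη.le le_rfl
  obtain ⟨β₁, hβ₁, -, hβG⟩ := exists_pos_mul_le (growth x) (half_pos hσ0)
  obtain ⟨β₂, hβ₂, -, hβQ⟩ := exists_pos_mul_le (A + Lam * J) (half_pos hη)
  set β := min β₁ β₂
  have hβ : 0 < β := lt_min hβ₁ hβ₂
  replace hβG := hβG β hβ.le (min_le_left _ _)
  replace hβQ := hβQ β hβ.le (min_le_right _ _)
  set R := (2 * M / β) ^ 2 + 2 * M / K
  obtain ⟨ρ, hρ, hunif⟩ := Metric.uniformContinuousOn_iff.1
    (((isCompact_closedBall (0 : EuclideanSpace ℝ (Fin n)) R).prod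
      (isCompact_Icc (a := 0) (b := T))).uniformContinuousOn_of_continuous
      (hu.continuousOn.mono fun p hp => ⟨trivial, hp.2.1⟩)) σ hσ0
  have hlayer : ∀ z, ‖z‖ ≤ R → ∀ t ∈ Set.Icc 0 T, t < ρ → |u z t - u z 0| < σ := by
    intro z hz t ht htρ
    have := hunif (z, t) ⟨by simpa using hz, ht⟩ (z, 0) ⟨by simpa using hz, le_rfl, hT⟩
      (by simpa [Prod.dist_eq, Real.dist_eq, abs_of_nonneg ht.1] using ⟨hρ, htρ⟩)
    simpa [Real.dist_eq] using this
  obtain ⟨ε, hε, -, hερ⟩ := exists_pos_mul_le (4 * M) (pow_pos hρ 2)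
  replace hερ := hερ ε hε.le le_rfl
  have hval : σ ≤ doubled u K δ β ε η x y T T := by
    simp only [doubled, sub_self, ne_eq, OfNat.ofNat_ne_zero, not_false_eq_true, zero_pow,
      zero_div]
    linarith
  obtain ⟨x₀, y₀, t₀, s₀, ht₀, hs₀, hmax⟩ := exists_isMax_doubled hu.continuousOn hM hK hδ hβ hε
    hη.le (T := T) ⟨hT, le_rfl⟩ ⟨hT, le_rfl⟩ (hσ0.trans_le hval)
  have hσmax := hval.trans (hmax x y T T hT le_rfl hT le_rfl)
  obtain ⟨hx₀, hy₀, hts⟩ := norm_le_of_doubled_pos hM hK hβ hε hη.le ht₀.1 hs₀.1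
    (hσ0.trans_le hσmax)
  have hclose : |t₀ - s₀| < ρ := abs_lt_of_sq_lt_sq (hts.trans_lt hερ) hρ.le
  have hG0 : 0 ≤ β * growth x₀ := mul_nonneg hβ.le (zero_le_one.trans (one_le_growth x₀))
  have hq0 : 0 ≤ (t₀ - s₀) ^ 2 / (2 * ε) := by positivity
  have hη0 : 0 ≤ η * t₀ := mul_nonneg hη.le ht₀.1
  have hN := mul_le_mul_of_nonneg_left (norm_le_smoothNorm δ (x₀ - y₀)) hK.le
  have hinit := h0 x₀ y₀
  rw [doubled] at hσmax
  rcases ht₀.1.eq_or_lt with rfl | ht₀'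
  · have := abs_lt.1 (hlayer y₀ hy₀ s₀ hs₀ (by
      rwa [zero_sub, abs_neg, abs_of_nonneg hs₀.1] at hclose))
    linarith
  rcases hs₀.1.eq_or_lt with rfl | hs₀'
  · have := abs_lt.1 (hlayer x₀ hx₀ t₀ ht₀ (by
      rwa [sub_zero, abs_of_nonneg ht₀.1] at hclose))
    linarith
  obtain ⟨q, hq, hq1, hqS⟩ := exists_pos_mul_le (Lam * (K / δ) * J) (half_pos hη)
  have hslope := slope_le_of_isMax hlam hb ha_meas ha_symm ha_ell hu hM hK.le hδ hβ.le hε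
    (r := q ^ 2) (by positivity) (pow_le_one₀ hq.le hq1) ht₀' ht₀.2 hs₀' hs₀.2 hmax
  rw [Real.sqrt_sq hq.le] at hslope
  have := hqS q hq.le le_rfl
  linarith

lemma lipSeminorm_le_iff {E : Type*} [MetricSpace E] {f : E → ℝ} {K : NNReal} :
    lipSeminorm f ≤ K ↔ LipschitzWith K f := by
  simp only [lipSeminorm, iSup_le_iff]
  refine forall_congr' fun x => forall_congr' fun y => ?_
  rcases eq_or_ne x y with rfl | h
  · simp
  · rw [ENNReal.div_le_iff (edist_pos.2 h).ne' (edist_ne_top x y)]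
    simp [h]

lemma lipschitzWith_of_initial {n : ℕ} {ι κ : Type*} {lam Lam : ℝ} (hlam : 0 < lam)
    {c : ι → κ → ℝ} {b : ι → κ → EuclideanSpace ℝ (Fin n)} {A : ℝ} (hb : ∀ i j, ‖b i j‖ ≤ A)
    {a : ι → κ → EuclideanSpace ℝ (Fin n) → ℝ}
    (ha_meas : ∀ i j, AEMeasurable (a i j) volume)
    (ha_symm : ∀ i j y, a i j y = a i j (-y))
    (ha_ell : ∀ i j y, lam ≤ a i j y ∧ a i j y ≤ Lam)
    {u : EuclideanSpace ℝ (Fin n) → ℝ → ℝ} (hu : IsViscositySolution c b a u)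
    {M : ℝ} (hM : ∀ x t, 0 ≤ t → |u x t| ≤ M) {K : NNReal}
    (h0 : LipschitzWith K fun x => u x 0) {t : ℝ} (ht : 0 ≤ t) :
    LipschitzWith K fun x => u x t := by
  rcases eq_or_ne n 0 with rfl | hn
  · exact LipschitzWith.of_le_add_mul K fun x y => by simp [Subsingleton.elim x y]
  have : NeZero n := ⟨hn⟩
  refine LipschitzWith.of_le_add_mul K fun x y => ?_
  have hlim : Tendsto (fun δ : ℝ => u y t + (K + δ) * (‖x - y‖ + δ)) (𝓝[>] 0)
      (𝓝 (u y t + K * dist x y)) := by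
    have : Continuous fun δ : ℝ => u y t + (K + δ) * (‖x - y‖ + δ) := by fun_prop
    simpa [dist_eq_norm] using (this.tendsto 0).mono_left nhdsWithin_le_nhds
  refine ge_of_tendsto hlim ?_
  filter_upwards [self_mem_nhdsWithin] with δ hδ
  have hδ0 : (0 : ℝ) < δ := hδ
  have hK : 0 < (K : ℝ) + δ := add_pos_of_nonneg_of_pos K.2 hδ0
  have h1 := sub_le_mul_smoothNorm hlam hb ha_meas ha_symm ha_ell hu hM hK hδ0 (fun x y => by
    have := (le_abs_self _).trans (h0.dist_le_mul x y)
    rw [dist_eq_norm] at this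
    exact this.trans (by gcongr; linarith)) ht x y
  have h2 := mul_le_mul_of_nonneg_left (smoothNorm_le hδ0.le (x - y)) hK.le
  linarith

end HamiltonJacobi

theorem lemmal {n : ℕ} {ι κ : Type*} (lam Lam : ℝ) (hlam : 0 < lam)
    (c : ι → κ → ℝ)
    (b : ι → κ → EuclideanSpace ℝ (Fin n)) (hb : ∃ A : ℝ, ∀ i j, ‖b i j‖ ≤ A)
    (a : ι → κ → EuclideanSpace ℝ (Fin n) → ℝ)
    (ha_meas : ∀ i j, AEMeasurable (a i j) volume)
    (ha_symm : ∀ i j y, a i j y = a i j (-y))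
    (ha_ell : ∀ i j y, lam ≤ a i j y ∧ a i j y ≤ Lam)
    (u : EuclideanSpace ℝ (Fin n) → ℝ → ℝ)
    (hu : HamiltonJacobi.IsViscositySolution c b a u)
    (hu_bdd : ∃ M : ℝ, ∀ x t, 0 ≤ t → |u x t| ≤ M)
    (hu₀ : ∃ K, LipschitzWith K (fun x => u x 0)) :
    ∀ t : ℝ, 0 ≤ t →
      (∃ K, LipschitzWith K (fun x => u x t)) ∧
        HamiltonJacobi.lipSeminorm (fun x => u x t) ≤
          HamiltonJacobi.lipSeminorm (fun x => u x 0) := by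
  intro t ht
  obtain ⟨A, hA⟩ := hb
  obtain ⟨M, hM⟩ := hu_bdd
  obtain ⟨K, hK⟩ := hu₀
  -- The seminorm at time zero is finite, hence itself a Lipschitz constant of `u(·, 0)`.
  have hfin : HamiltonJacobi.lipSeminorm (fun x => u x 0) ≠ ∞ :=
    ne_top_of_le_ne_top ENNReal.coe_ne_top (HamiltonJacobi.lipSeminorm_le_iff.2 hK)
  lift HamiltonJacobi.lipSeminorm (fun x => u x 0) to NNReal using hfin with L hL
  have h0 : LipschitzWith L fun x => u x 0 := HamiltonJacobi.lipSeminorm_le_iff.1 hL.symm.le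
  have := HamiltonJacobi.lipschitzWith_of_initial hlam hA ha_meas ha_symm ha_ell hu hM h0 ht
  exact ⟨⟨L, this⟩, HamiltonJacobi.lipSeminorm_le_iff.2 this⟩
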